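/- Let $F\subseteq L$ be a field extension. Let $\mathrm{Zar}(L|F)$ be the set of all valuation domains that contain $F$ and have quotient field $L$ (the field $L$ itself is one of them), endowed with the Zariski topology, i.e. the topology whose open sets are generated by the sets $\{V\in\mathrm{Zar}(L|F) : x_1,\dots,x_n\in V\}$ for $x_1,\dots,x_n\in L$. Let $\mathrm{Zar}_{\min}(L|F)$ be the set of minimal elements of $\mathrm{Zar}(L|F)$ with respect to containment, with the subspace topology. A topological space is Noetherian if its open sets satisfy the ascending chain condition. (a) If $\operatorname{trdeg}_F L=0$, then $\mathrm{Zar}(L|F)=\{L\}=\mathrm{Zar}_{\min}(L|F)$; in particular, both spaces are Noetherian. (b) If $\operatorname{trdeg}_F L\geq 2$, then neither $\mathrm{Zar}(L|F)$ nor $\mathrm{Zar}_{\min}(L|F)$ is Noetherian. -/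

import Mathlib

namespace ZariskiSpace

variable (D K : Type*) [CommRing D] [Field K] [Algebra D K]

/-- The set of the rings `A` with `D ⊆ A ⊆ K` is `Subalgebra D K`. Its Zariski topology is generated
by the sets `B(x₁, …, xₙ)` of the rings containing the finitely many elements `x₁, …, xₙ` of `K`. -/
instance zariskiTopology : TopologicalSpace (Subalgebra D K) :=
  TopologicalSpace.generateFrom
    {U | ∃ s : Finset K, U = {A : Subalgebra D K | ∀ x ∈ s, x ∈ A}}

/-- The Zariski space `Zar(K|D)`: the valuation domains that contain `D` and have quotient
field `K`. As a subset of `Subalgebra D K` it carries the subspace topology. -/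
def Zar : Set (Subalgebra D K) :=
  {V | ValuationRing V ∧ IsFractionRing V K}

/-- The set of the minimal elements of `Zar(K|D)` with respect to containment. -/
def Zarmin : Set (Subalgebra D K) :=
  {V | Minimal (fun W => W ∈ Zar D K) V}

end ZariskiSpace

namespace ZariskiSpace

open TopologicalSpace

section Field

variable {F L : Type*} [Field F] [Field L] [Algebra F L]

/-! In an algebraic extension every intermediate ring is closed under inverses, so only `⊤` is a
valuation ring. If `x`, `y` are algebraically independent, the open sets given by `x, x ^ n / y ∈ V`
grow strictly with `n`, already on `Zarmin`, by `exists_mem_Zarmin_pow_div_mem`; `Zar` inherits the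
failure since subspaces of Noetherian spaces are Noetherian. -/

theorem mem_Zar_iff {V : Subalgebra F L} : V ∈ Zar F L ↔ ∀ a : L, a ∈ V ∨ a⁻¹ ∈ V := by
  constructor
  · rintro ⟨h₁, h₂⟩ a
    rcases (ValuationRing.iff_isInteger_or_isInteger V L).1 h₁ a with ⟨b, hb⟩ | ⟨b, hb⟩
    · exact Or.inl (hb ▸ b.2)
    · exact Or.inr (hb ▸ b.2)
  · intro h
    have hfrac : IsFractionRing V L := by
      refine IsFractionRing.of_field V L fun a => ?_
      rcases h a with ha | ha
      · exact ⟨⟨a, ha⟩, 1, by simp [Algebra.algebraMap_eq_smul_one, Subalgebra.smul_def]⟩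
      · exact ⟨1, ⟨a⁻¹, ha⟩, by simp [Algebra.algebraMap_eq_smul_one, Subalgebra.smul_def]⟩
    refine ⟨(ValuationRing.iff_isInteger_or_isInteger V L).2 fun a => ?_, hfrac⟩
    exact (h a).imp (fun ha => ⟨⟨a, ha⟩, rfl⟩) fun ha => ⟨⟨a⁻¹, ha⟩, rfl⟩

theorem top_mem_Zar : (⊤ : Subalgebra F L) ∈ Zar F L :=
  mem_Zar_iff.2 fun _ => Or.inl trivial

theorem Zarmin_subset_Zar : Zarmin F L ⊆ Zar F L := fun _ h => h.prop

theorem Zar_eq_singleton_top [Algebra.IsAlgebraic F L] : Zar F L = {⊤} := by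
  refine Set.eq_singleton_iff_unique_mem.2 ⟨top_mem_Zar, fun V hV => ?_⟩
  refine eq_top_iff.2 fun a _ => (mem_Zar_iff.1 hV a).elim id fun ha => ?_
  simpa using V.inv_mem_of_algebraic (x := ⟨a⁻¹, ha⟩) (Algebra.IsAlgebraic.isAlgebraic a⁻¹)

theorem Zarmin_eq_singleton_top [Algebra.IsAlgebraic F L] : Zarmin F L = {⊤} := by
  ext V
  simp only [Zarmin, Zar_eq_singleton_top, Set.mem_singleton_iff, Set.mem_ofPred_eq]
  exact minimal_eq_iff

/-- Zorn's lemma for reversed inclusion: the intersection of a chain of valuation rings is again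
one. -/
theorem exists_mem_Zarmin_le {V : Subalgebra F L} (hV : V ∈ Zar F L) :
    ∃ W ∈ Zarmin F L, W ≤ V := by
  have ih : ∀ c ⊆ OrderDual.ofDual ⁻¹' Zar F L, IsChain (· ≤ ·) c → ∀ y ∈ c,
      ∃ ub ∈ OrderDual.ofDual ⁻¹' Zar F L, ∀ z ∈ c, z ≤ ub := by
    intro c hc hchain _ _
    refine ⟨OrderDual.toDual (sInf (OrderDual.toDual ⁻¹' c)), mem_Zar_iff.2 fun a => ?_,
      fun U hU => sInf_le (a := OrderDual.ofDual U) hU⟩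
    change a ∈ sInf _ ∨ a⁻¹ ∈ sInf _
    simp only [Algebra.mem_sInf]
    by_contra! h
    obtain ⟨⟨A, hA, haA⟩, B, hB, haB⟩ := h
    rcases hchain.total hA hB with hAB | hAB
    · exact (mem_Zar_iff.1 (hc hB) a).elim (fun h => haA (hAB h)) haB
    · exact (mem_Zar_iff.1 (hc hA) a).elim haA fun h => haB (hAB h)
  obtain ⟨W, hWV, hW⟩ := zorn_le_nonempty₀ _ ih (OrderDual.toDual V) hV
  exact ⟨OrderDual.ofDual W, ⟨hW.prop, fun U hU h => hW.le_of_ge (y := OrderDual.toDual U) hU h⟩,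
    hWV⟩

/-- Two algebraically independent elements lie in the maximal ideal of some valuation ring. -/
theorem exists_mem_Zar_inv_notMem {x z : L} (hx : Transcendental F x)
    (hz : Transcendental (Algebra.adjoin F {x}) z) :
    ∃ V ∈ Zar F L, x⁻¹ ∉ V ∧ z⁻¹ ∉ V := by
  let f : Option Unit → L := fun o => o.elim z fun _ => x
  have hf : AlgebraicIndependent F f := by
    refine AlgebraicIndependent.option_iff.2
      ⟨algebraicIndependent_unique_type_iff.2 hx, ?_⟩
    rwa [Set.range_const]
  let A := Algebra.adjoin F (Set.range f)
  -- Evaluation at the origin; a valuation ring dominating its kernel has `x` and `z` as nonunits.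
  let φ : A →ₐ[F] F := (MvPolynomial.aeval fun _ => (0 : F)).comp hf.aevalEquiv.symm.toAlgHom
  obtain ⟨B, hAB, hIB⟩ := Ideal.image_subset_nonunits_valuationSubring (A := A.toSubring)
    (RingHom.ker φ) (RingHom.ker_ne_top φ)
  have key : ∀ i, f i ≠ 0 → (f i)⁻¹ ∉ B := by
    intro i hi
    have hfi : f i ∈ B.nonunits := by
      refine hIB ⟨hf.aevalEquiv (MvPolynomial.X i), ?_,
        (hf.algebraMap_aevalEquiv _).trans (MvPolynomial.aeval_X f i)⟩
      change φ _ = 0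
      simp [φ]
    exact (B.mem_nonunits_iff_or.1 hfi).resolve_left hi
  have hx0 : x ≠ 0 := fun h => hx (h ▸ isAlgebraic_zero)
  have hz0 : z ≠ 0 := fun h => hz (h ▸ isAlgebraic_zero)
  let V : Subalgebra F L :=
    { B.toSubring with algebraMap_mem' := fun r => hAB (A.algebraMap_mem r) }
  exact ⟨V, mem_Zar_iff.2 B.mem_or_inv_mem, key (some ()) hx0, key none hz0⟩

theorem isOpen_setOf_mem_and_mem (x y : L) : IsOpen {V : Subalgebra F L | x ∈ V ∧ y ∈ V} := by
  classical
  exact isOpen_generateFrom_of_mem ⟨{x, y}, by simp⟩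

/-- A minimal valuation ring in which the value of `y` is `n + 1` times that of `x`. -/
theorem exists_mem_Zarmin_pow_div_mem {x y : L} (hx : Transcendental F x)
    (hy : Transcendental (Algebra.adjoin F {x}) y) (n : ℕ) :
    ∃ W ∈ Zarmin F L, x ∈ W ∧ x ^ (n + 1) / y ∈ W ∧ x ^ n / y ∉ W := by
  have hx0 : x ≠ 0 := fun h => hx (h ▸ isAlgebraic_zero)
  have hy0 : y ≠ 0 := fun h => hy (h ▸ isAlgebraic_zero)
  have hxalg : IsAlgebraic (Algebra.adjoin F {x}) x :=
    isAlgebraic_algebraMap (⟨x, Algebra.self_mem_adjoin_singleton F x⟩ : Algebra.adjoin F {x})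
  -- Once `z` is a nonunit, `z + 1` is a unit, which forces the value of `y`.
  obtain ⟨z, hyz⟩ : ∃ z, y = (z + 1) * x ^ (n + 1) :=
    ⟨y / x ^ (n + 1) - 1, by field_simp; ring⟩
  have hz : Transcendental (Algebra.adjoin F {x}) z := fun h =>
    hy (hyz ▸ (h.add isAlgebraic_one).mul (hxalg.pow _))
  have hz0 : z ≠ 0 := fun h => hz (h ▸ isAlgebraic_zero)
  have hz1 : z + 1 ≠ 0 := fun h => hy0 (by rw [hyz, h, zero_mul])
  obtain ⟨V, hV, hxV, hzV⟩ := exists_mem_Zar_inv_notMem hx hz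
  obtain ⟨W, hW, hWV⟩ := exists_mem_Zarmin_le hV
  have hW' := mem_Zar_iff.1 (Zarmin_subset_Zar hW)
  have hxW : x⁻¹ ∉ W := fun h => hxV (hWV h)
  have hzW : z⁻¹ ∉ W := fun h => hzV (hWV h)
  have hxm : x ∈ W := (hW' x).resolve_right hxW
  have hzm : z ∈ W := (hW' z).resolve_right hzW
  refine ⟨W, hW, hxm, ?_, fun h => hxW ?_⟩
  -- `x ^ (n + 1) / y = 1 - z / (z + 1)`, while `(z + 1) / z ∈ W` would give `z⁻¹ ∈ W`.
  · rcases hW' (z / (z + 1)) with h | h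
    · convert W.sub_mem W.one_mem h using 1
      rw [hyz]
      field_simp
      ring
    · refine absurd ?_ hzW
      convert W.sub_mem h W.one_mem using 1
      field_simp
      ring
  -- `(z + 1) * (x ^ n / y) = x⁻¹`.
  · convert W.mul_mem (W.add_mem hzm W.one_mem) h using 1
    rw [hyz]
    field_simp
    ring

theorem exists_transcendental_adjoin_of_two_le_trdeg (h : 2 ≤ Algebra.trdeg F L) :
    ∃ x y : L, Transcendental F x ∧ Transcendental (Algebra.adjoin F {x}) y := by
  have h0 : Algebra.trdeg F L ≠ 0 := fun h0 => by simp [h0] at h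
  obtain ⟨x, hx⟩ := (trdeg_ne_zero_iff.1 h0).transcendental
  by_contra! hcon
  have : Algebra.IsAlgebraic (Algebra.adjoin F {x}) L :=
    ⟨fun y => not_not.1 (hcon x y hx)⟩
  have h1 := h.trans (Algebra.IsAlgebraic.trdeg_le_cardinalMk (R := F) (s := ({x} : Set L)))
  rw [Cardinal.mk_singleton] at h1
  exact absurd h1 (by norm_num)

theorem not_noetherianSpace_Zarmin (h : 2 ≤ Algebra.trdeg F L) :
    ¬ NoetherianSpace (Zarmin F L) := by
  intro hN
  obtain ⟨x, y, hx, hy⟩ := exists_transcendental_adjoin_of_two_le_trdeg h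
  let U : ℕ → Opens (Zarmin F L) := fun n =>
    ⟨{V | x ∈ V.1 ∧ x ^ n / y ∈ V.1},
      (isOpen_setOf_mem_and_mem x (x ^ n / y)).preimage continuous_subtype_val⟩
  have hU : StrictMono U := by
    refine strictMono_nat_of_lt_succ fun n => ?_
    refine lt_of_le_not_ge (fun V hV => ⟨hV.1, ?_⟩) fun hle => ?_
    · rw [pow_succ', mul_div_assoc]
      exact V.1.mul_mem hV.1 hV.2
    · obtain ⟨W, hW, hxW, h₁, h₂⟩ := exists_mem_Zarmin_pow_div_mem hx hy n
      exact h₂ (hle (show (⟨W, hW⟩ : Zarmin F L) ∈ U (n + 1) from ⟨hxW, h₁⟩)).2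
  exact not_strictMono_of_wellFoundedGT U hU

theorem not_noetherianSpace_Zar (h : 2 ≤ Algebra.trdeg F L) :
    ¬ NoetherianSpace (Zar F L) := fun _ =>
  not_noetherianSpace_Zarmin h
    (Topology.IsInducing.noetherianSpace
      (Topology.IsEmbedding.inclusion (Zarmin_subset_Zar (F := F) (L := L))).isInducing)

end Field

end ZariskiSpace

theorem mainTheorem6 {F : Type*} {L : Type*} [Field F] [Field L] [Algebra F L] :
    (Algebra.trdeg F L = 0 →
      ZariskiSpace.Zar F L = {⊤} ∧ ZariskiSpace.Zarmin F L = {⊤} ∧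
      TopologicalSpace.NoetherianSpace (ZariskiSpace.Zar F L) ∧
      TopologicalSpace.NoetherianSpace (ZariskiSpace.Zarmin F L)) ∧
    (2 ≤ Algebra.trdeg F L →
      ¬ TopologicalSpace.NoetherianSpace (ZariskiSpace.Zar F L) ∧
      ¬ TopologicalSpace.NoetherianSpace (ZariskiSpace.Zarmin F L)) := by
  refine ⟨fun h => ?_, fun h => ⟨ZariskiSpace.not_noetherianSpace_Zar h,
    ZariskiSpace.not_noetherianSpace_Zarmin h⟩⟩
  have : Algebra.IsAlgebraic F L := trdeg_eq_zero_iff.1 h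
  refine ⟨ZariskiSpace.Zar_eq_singleton_top, ZariskiSpace.Zarmin_eq_singleton_top, ?_, ?_⟩
  · rw [ZariskiSpace.Zar_eq_singleton_top]
    infer_instance
  · rw [ZariskiSpace.Zarmin_eq_singleton_top]
    infer_instance
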